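/- Let $w$ be a finite word over an arbitrary alphabet, let $|w|$ be its length and let $\mathrm{Alph}(w)$ be the set of letters occurring in $w$. A factor of $w$ is a word $x$ such that $w = yxz$ for some (possibly empty) words $y, z$. Let $\mathrm{Powers}(w)$ be the set of all (distinct) factors of $w$ of the form $u^t$, the concatenation of $t$ copies of $u$, where $u$ is a nonempty word and $t \ge 2$ is an integer. Then $\mathrm{Powers}(w)$ is finite and $$|\mathrm{Powers}(w)| \le |w| - |\mathrm{Alph}(w)|.$$ In particular, if $w$ is nonempty, then $|\mathrm{Powers}(w)| \le |w| - 1$. -/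

import Mathlib

namespace FiniteWord

variable {α : Type*}

/-- The word `u ^ t`: the concatenation of `t` copies of the word `u`. -/
def wordPow (u : List α) (t : ℕ) : List α := (List.replicate t u).flatten

/-- `Fac(w)`: the set of factors (contiguous subwords) of `w`. -/
def Fac (w : List α) : Set (List α) := {u | u <:+: w}

/-- `Alph(w)`: the set of letters occurring in `w`. -/
def Alph (w : List α) : Set α := {a | a ∈ w}

/-- `Powers(w)`: the set of factors of `w` of the form `u ^ t` with `u` a nonempty word
and `t ≥ 2` an integer. It is a set of words, so each is counted once, whatever the number of
its occurrences and of its representations as a power. -/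
def Powers (w : List α) : Set (List α) :=
  {x | x ∈ Fac w ∧ ∃ (u : List α) (t : ℕ), u ≠ [] ∧ 2 ≤ t ∧ x = wordPow u t}

end FiniteWord

namespace FiniteWord

open Finset

/-! In the Rauzy graph of order n, vertices are the factors of length n and edges those of length n
+ 1. A primitive word of length p ≤ n, up to conjugacy, is a small circuit if its infinite power has
all its factors of length n + 1 in w. Small circuits number at most edges - vertices + 1
(`card_factors_add_card_le`): deleting the least edge of each keeps the graph connected. Summed over
1 ≤ n < |w|, this telescopes to |w| - |Alph w|. Each conjugacy class has at most as many powers in w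
as orders at which it is a circuit (`card_powerPairs_le`). -/

/-- The word of length `L` read off the sequence `f` from position `i` on. -/
def window {α : Type*} (f : ℕ → α) (i L : ℕ) : List α := (List.range L).map fun j => f (i + j)

section Window

variable {α : Type*} {f f' : ℕ → α} {i j L n : ℕ}

@[simp]
theorem length_window : (window f i L).length = L := by simp [window]

theorem window_eq_iff : window f i L = window f' j L ↔ ∀ m < L, f (i + m) = f' (j + m) := by
  simp [window, List.map_inj_left]

theorem window_add (a b : ℕ) : window f i (a + b) = window f i a ++ window f (i + a) b := by
  simp [window, List.range_add, Function.comp_def, add_assoc]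

theorem tail_window : (window f i (n + 1)).tail = window f (i + 1) n := by
  rw [add_comm n 1, window_add]
  simp [window]

theorem dropLast_window : (window f i (n + 1)).dropLast = window f i n := by
  rw [window_add]
  simp [window]

theorem window_succ_congr (h : window f i (n + 1) = window f' j (n + 1)) :
    window f i n = window f' j n ∧ window f (i + 1) n = window f' (j + 1) n :=
  ⟨by rw [← dropLast_window, h, dropLast_window], by rw [← tail_window, h, tail_window]⟩

end Window

/-! ### Lyndon sequences as canonical representatives of circuits -/

/-- A sequence of period `p` that is lexicographically smaller than all its shifts by less
than `p`: the infinite power of a Lyndon word of length `p`. -/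
structure IsLyndon {α : Type*} [LinearOrder α] (p : ℕ) (f : ℕ → α) : Prop where
  pos : 0 < p
  periodic : Function.Periodic f p
  lt_shift : ∀ d, 0 < d → d < p → toLex f < toLex fun k => f (d + k)

section Lyndon

variable {α : Type*} [LinearOrder α] {p p' : ℕ} {f f' : ℕ → α}

/-- A border of length p - q pushes the first difference with the shift by q past it; read there, it
reverses the inequality with the shift by p - q. -/
theorem IsLyndon.unbordered (h : IsLyndon p f) {q : ℕ} (hq : 0 < q) (hqp : q < p)
    (hf : ∀ i, i + q < p → f (i + q) = f i) : False := by
  obtain ⟨k, hk, hk'⟩ := h.lt_shift q hq hqp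
  obtain ⟨l, hl, hl'⟩ := h.lt_shift (p - q) (by omega) (by omega)
  simp only [Pi.toLex_apply] at hk hk' hl hl'
  have hper (r : ℕ) : f (q + (p - q + r)) = f r := by
    rw [show q + (p - q + r) = r + p by omega, h.periodic]
  have hkp : p - q ≤ k := by
    by_contra hlt
    rw [add_comm, hf k (by omega)] at hk'
    exact lt_irrefl _ hk'
  obtain ⟨r, rfl⟩ := Nat.exists_eq_add_of_le hkp
  rw [hper] at hk'
  rcases lt_trichotomy l r with hlr | rfl | hlr
  · have := hk (p - q + l) (by omega)
    rw [hper] at this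
    rw [this] at hl'
    exact lt_irrefl _ hl'
  · exact lt_asymm hk' hl'
  · rw [← hl r hlr] at hk'
    exact lt_irrefl _ hk'

/-- A smaller p' would be a period of the first p letters of f, giving a border. -/
theorem IsLyndon.period_le (h : IsLyndon p f) (h' : IsLyndon p' f') {n j : ℕ} (hn : p ≤ n)
    (he : window f 0 (n + 1) = window f' j (n + 1)) : p ≤ p' := by
  rw [window_eq_iff] at he
  by_contra hlt
  refine h.unbordered h'.pos (not_le.1 hlt) fun i hi => ?_
  have h1 := he (i + p') (by omega)
  have h2 := he i (by omega)
  rw [← add_assoc j, h'.periodic] at h1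
  rw [zero_add] at h1 h2
  rw [h1, h2]

theorem IsLyndon.eq_of_window_eq (h : IsLyndon p f) (h' : IsLyndon p f') {n j : ℕ} (hn : p ≤ n)
    (hj : j < p) (he : window f 0 (n + 1) = window f' j (n + 1)) : j = 0 ∧ f = f' := by
  rw [window_eq_iff] at he
  have hf : f = fun k => f' (j + k) := by
    funext k
    have h1 := he (k % p) ((Nat.mod_lt _ h.pos).trans_le (by omega))
    have h3 : f' (j + k % p) = f' (j + k) := by
      have := (h'.periodic.nat_mul (k / p)) (j + k % p)
      rw [← this]
      congr 1
      have := Nat.mod_add_div' k p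
      push_cast
      omega
    rw [zero_add, h.periodic.map_mod_nat, h3] at h1
    exact h1
  rcases Nat.eq_zero_or_pos j with rfl | hj0
  · exact ⟨rfl, by simpa using hf⟩
  · have h1 := h'.lt_shift j hj0 hj
    have h2 := h.lt_shift (p - j) (by omega) (by omega)
    have h3 : (fun k => f (p - j + k)) = f' := by
      funext k
      rw [hf]
      simp only
      rw [show j + (p - j + k) = k + p by omega, h'.periodic]
    rw [h3] at h2
    rw [← hf] at h1
    exact absurd h1 (lt_asymm h2)

end Lyndon

/-! ### Factors of a given length -/

section Factors

open scoped Classical in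
/-- The factors of length `n` of the word formed by the first `N` terms of `g`. -/
noncomputable def factors {α : Type*} (g : ℕ → α) (N n : ℕ) : Finset (List α) :=
  (range (N + 1 - n)).image fun i => window g i n

variable {α : Type*} {g : ℕ → α} {N n : ℕ}

theorem mem_factors {x : List α} : x ∈ factors g N n ↔ ∃ i, i + n ≤ N ∧ window g i n = x := by
  simp only [factors, mem_image, mem_range]
  exact exists_congr fun i => and_congr_left fun _ => by omega

theorem window_mem_factors {i : ℕ} (h : i + n ≤ N) : window g i n ∈ factors g N n :=
  mem_factors.2 ⟨i, h, rfl⟩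

theorem window_mem_factors_of_le {f : ℕ → α} {i L j M : ℕ} (h : window f i L ∈ factors g N L)
    (hj : i ≤ j) (hM : j + M ≤ i + L) : window f j M ∈ factors g N M := by
  obtain ⟨k, hk, he⟩ := mem_factors.1 h
  rw [window_eq_iff] at he
  refine mem_factors.2 ⟨k + (j - i), by omega, window_eq_iff.2 fun m hm => ?_⟩
  have := he (j - i + m) (by omega)
  rw [← add_assoc, ← add_assoc] at this
  rw [this]
  congr 1
  omega

theorem card_factors_self_le : (factors g N N).card ≤ 1 := by
  classical
  exact card_image_le.trans (by simp)

theorem tail_mem_factors {e : List α} (h : e ∈ factors g N (n + 1)) :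
    e.tail ∈ factors g N n := by
  obtain ⟨i, hi, rfl⟩ := mem_factors.1 h
  rw [tail_window]
  exact window_mem_factors (by omega)

theorem dropLast_mem_factors {e : List α} (h : e ∈ factors g N (n + 1)) :
    e.dropLast ∈ factors g N n := by
  obtain ⟨i, hi, rfl⟩ := mem_factors.1 h
  rw [dropLast_window]
  exact window_mem_factors (by omega)

end Factors

/-! ### Circuit rank of Rauzy graphs -/

section Rauzy

variable {α : Type*} [LinearOrder α] {g : ℕ → α} {N n : ℕ}

/-- Deleting from the Rauzy graph the least edge of each of its small circuits does not
disconnect the ends of the deleted edges. -/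
theorem eq_along_circuit {β : Type*} {H : List α → β} {S : Finset (ℕ × (ℕ → α))}
    (hS : ∀ c ∈ S, IsLyndon c.1 c.2 ∧ c.1 ≤ n ∧
      ∀ i, window c.2 i (n + 1) ∈ factors g N (n + 1))
    (hH : ∀ e ∈ factors g N (n + 1), (∀ c ∈ S, e ≠ window c.2 0 (n + 1)) →
      H e.tail = H e.dropLast) (p : ℕ) :
    ∀ c ∈ S, c.1 = p → H (window c.2 1 n) = H (window c.2 0 n) := by
  induction p using Nat.strong_induction_on with
  | _ p ih =>
    rintro c hc rfl
    obtain ⟨hL, hle, hmem⟩ := hS c hc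
    have step (i : ℕ) (hi : 0 < i) (hic : i < c.1) :
        H (window c.2 (i + 1) n) = H (window c.2 i n) := by
      -- A deleted edge other than the least edge of c belongs to a circuit of strictly smaller
      -- period, so induction bypasses it.
      by_cases hex : ∃ d ∈ S, window d.2 0 (n + 1) = window c.2 i (n + 1)
      · obtain ⟨d, hd, he⟩ := hex
        obtain ⟨hLd, hled, -⟩ := hS d hd
        have hdc := hLd.period_le hL hled he
        rcases hdc.eq_or_lt with heq | hlt
        · rw [heq] at hLd
          exact absurd (hLd.eq_of_window_eq hL hle hic he).1 hi.ne'
        · obtain ⟨e1, e2⟩ := window_succ_congr he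
          rw [← e1, ← e2]
          exact ih _ hlt d hd rfl
      · push Not at hex
        have := hH _ (hmem i) fun d hd => (hex d hd).symm
        rwa [tail_window, dropLast_window] at this
    have chain (i : ℕ) (hi : i + 1 ≤ c.1) : H (window c.2 (i + 1) n) = H (window c.2 1 n) := by
      induction i with
      | zero => rfl
      | succ i ihi => rw [step (i + 1) (by omega) (by omega), ihi (by omega)]
    have hpos := hL.pos
    rw [← chain (c.1 - 1) (by omega)]
    congr 1
    rw [window_eq_iff]
    intro m _
    rw [show c.1 - 1 + 1 + m = 0 + m + c.1 by omega, hL.periodic]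

/-- The number of small circuits of the Rauzy graph is at most its circuit rank. -/
theorem card_factors_add_card_le (S : Finset (ℕ × (ℕ → α)))
    (hS : ∀ c ∈ S, IsLyndon c.1 c.2 ∧ c.1 ≤ n ∧
      ∀ i, window c.2 i (n + 1) ∈ factors g N (n + 1)) :
    (factors g N n).card + S.card ≤ (factors g N (n + 1)).card + 1 := by
  classical
  set V := factors g N n
  set R := S.image fun c => window c.2 0 (n + 1)
  have hR : R ⊆ factors g N (n + 1) := by
    intro e he
    obtain ⟨c, hc, rfl⟩ := mem_image.1 he
    exact (hS c hc).2.2 0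
  have hcard : R.card = S.card := by
    refine card_image_of_injOn fun c hc d hd he => ?_
    obtain ⟨hc1, hc2, -⟩ := hS c hc
    obtain ⟨hd1, hd2, -⟩ := hS d hd
    have heq := le_antisymm (hc1.period_le hd1 hc2 he) (hd1.period_le hc1 hd2 he.symm)
    rw [← heq] at hd1
    exact Prod.ext heq (hc1.eq_of_window_eq hd1 hc2 hc1.pos he).2
  set E := factors g N (n + 1) \ R
  have hE : ∀ e ∈ E, e ∈ factors g N (n + 1) := fun e he => (mem_sdiff.1 he).1
  -- Coboundary map of the remaining graph; connectedness means that its kernel is the constants.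
  let T : (V → ℚ) →ₗ[ℚ] (E → ℚ) :=
    { toFun := fun h e => h ⟨e.1.tail, tail_mem_factors (hE _ e.2)⟩ -
        h ⟨e.1.dropLast, dropLast_mem_factors (hE _ e.2)⟩
      map_add' := fun a b => by funext e; simp only [Pi.add_apply]; ring
      map_smul' := fun a b => by
        funext e; simp only [Pi.smul_apply, smul_eq_mul, RingHom.id_apply]; ring }
  have hker : Module.finrank ℚ (LinearMap.ker T) ≤ 1 := by
    have hone : (fun _ => 1 : V → ℚ) ∈ LinearMap.ker T := by
      rw [LinearMap.mem_ker]
      funext e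
      simp [T]
    refine finrank_le_one ⟨_, hone⟩ fun ⟨h, hh⟩ => ?_
    let H : List α → ℚ := fun x => if hx : x ∈ V then h ⟨x, hx⟩ else 0
    have hH : ∀ e ∈ factors g N (n + 1), (∀ c ∈ S, e ≠ window c.2 0 (n + 1)) →
        H e.tail = H e.dropLast := by
      intro e he hne
      have heE : e ∈ E := by
        refine mem_sdiff.2 ⟨he, fun hr => ?_⟩
        obtain ⟨c, hc, hce⟩ := mem_image.1 hr
        exact hne c hc hce.symm
      have h1 := congrFun (LinearMap.mem_ker.1 hh) ⟨e, heE⟩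
      simp only [T, LinearMap.coe_mk, AddHom.coe_mk, Pi.zero_apply, sub_eq_zero] at h1
      simp only [H]
      rw [dif_pos (tail_mem_factors he), dif_pos (dropLast_mem_factors he), h1]
    have hstep (i : ℕ) (hi : i + (n + 1) ≤ N) : H (window g (i + 1) n) = H (window g i n) := by
      by_cases hex : ∃ c ∈ S, window g i (n + 1) = window c.2 0 (n + 1)
      · obtain ⟨c, hc, he⟩ := hex
        obtain ⟨e1, e2⟩ := window_succ_congr he
        rw [e1, e2]
        exact eq_along_circuit hS hH _ c hc rfl
      · push Not at hex
        have := hH _ (window_mem_factors hi) hex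
        rwa [tail_window, dropLast_window] at this
    have hconst (i : ℕ) (hi : i + n ≤ N) : H (window g i n) = H (window g 0 n) := by
      induction i with
      | zero => rfl
      | succ i ih => rw [hstep i (by omega), ih (by omega)]
    refine ⟨H (window g 0 n), Subtype.ext (funext fun v => ?_)⟩
    obtain ⟨i, hi, hv⟩ := mem_factors.1 v.2
    simp only [SetLike.mk_smul_mk, Pi.smul_apply, smul_eq_mul, mul_one]
    rw [← hconst i hi, hv]
    simp [H]
  have hrank := T.finrank_range_add_finrank_ker
  have hrange := (LinearMap.range T).finrank_le
  rw [Module.finrank_fintype_fun_eq_card, Fintype.card_coe] at hrank hrange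
  have hEc : E.card = (factors g N (n + 1)).card - R.card := card_sdiff_of_subset hR
  have := card_le_card hR
  omega

end Rauzy

/-! ### Powers against circuit orders -/

section Count

open scoped Classical in
/-- The pairs `(i, t)` for which the power of exponent `t ≥ 2` of the `i`-th conjugate of the
period of `f` is a factor. -/
noncomputable def powerPairs {α : Type*} (g : ℕ → α) (N p : ℕ) (f : ℕ → α) : Finset (ℕ × ℕ) :=
  (range p ×ˢ range (N + 1)).filter fun a =>
    2 ≤ a.2 ∧ window f a.1 (a.2 * p) ∈ factors g N (a.2 * p)

open scoped Classical in
/-- The orders of the Rauzy graphs in which `f` is a small circuit. -/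
noncomputable def circuitOrders {α : Type*} (g : ℕ → α) (N p : ℕ) (f : ℕ → α) : Finset ℕ :=
  (range N).filter fun n => p ≤ n ∧ ∀ i, window f i (n + 1) ∈ factors g N (n + 1)

variable {α : Type*} {g f : ℕ → α} {N p : ℕ}

theorem mem_powerPairs {a : ℕ × ℕ} : a ∈ powerPairs g N p f ↔
    (a.1 < p ∧ a.2 < N + 1) ∧ 2 ≤ a.2 ∧ window f a.1 (a.2 * p) ∈ factors g N (a.2 * p) := by
  simp [powerPairs]

theorem mem_circuitOrders {n : ℕ} : n ∈ circuitOrders g N p f ↔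
    n < N ∧ p ≤ n ∧ ∀ i, window f i (n + 1) ∈ factors g N (n + 1) := by
  simp [circuitOrders]

/-- Among p - |I| + 1 consecutive residues mod p, one lies in I; the long window starting there
covers the wanted one. -/
theorem window_mem_factors_of_card (hp : 0 < p) (hf : Function.Periodic f p) {I : Finset ℕ}
    (hI : I ⊆ range p) {M L : ℕ} (hmem : ∀ i ∈ I, window f i M ∈ factors g N M)
    (hL : L + p ≤ M + I.card) (hI0 : I.Nonempty) (i : ℕ) : window f i L ∈ factors g N L := by
  classical
  have hIp : I.card ≤ p := by simpa using card_le_card hI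
  have hshift (a b : ℕ) (hab : a % p = b % p) : window f a L = window f b L := by
    rw [window_eq_iff]
    intro m _
    rw [← hf.map_mod_nat (a + m), ← hf.map_mod_nat (b + m)]
    congr 1
    exact Nat.ModEq.add_right m hab
  -- The multiple p * p of p keeps the subtraction from truncating.
  let J := (range (p - I.card + 1)).image fun d => (i + p * p - d) % p
  have hpp : p ≤ p * p := Nat.le_mul_of_pos_left p hp
  have hI1 := hI0.card_pos
  have hJ : J.card = p - I.card + 1 := by
    rw [card_image_of_injOn, card_range]
    intro a ha b hb hab
    simp only [coe_range, Set.mem_Iio] at ha hb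
    have h1 : (i + p * p - a) ≡ (i + p * p - b) [MOD p] := hab
    have h2 : a ≡ b [MOD p] := by
      have h3 := (h1.add_right (a + b))
      rw [show i + p * p - a + (a + b) = b + (i + p * p) by omega,
        show i + p * p - b + (a + b) = a + (i + p * p) by omega] at h3
      exact (Nat.ModEq.add_right_cancel' _ h3).symm
    rw [Nat.ModEq, Nat.mod_eq_of_lt (by omega), Nat.mod_eq_of_lt (by omega)] at h2
    exact h2
  have hJp : J ⊆ range p := by
    intro x hx
    obtain ⟨d, -, rfl⟩ := mem_image.1 hx
    exact mem_range.2 (Nat.mod_lt _ hp)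
  have hint : ¬ Disjoint I J := by
    intro hd
    have := card_le_card (union_subset hI hJp)
    rw [card_union_of_disjoint hd, hJ, card_range] at this
    omega
  obtain ⟨x, hxI, hxJ⟩ := not_disjoint_iff.1 hint
  obtain ⟨d, hd, hdx⟩ := mem_image.1 hxJ
  rw [mem_range] at hd
  have hmod : (x + d) % p = i % p := by
    have h1 : x + d ≡ i + p * p - d + d [MOD p] := by
      rw [← hdx]
      exact (Nat.mod_modEq _ _).add_right d
    rw [Nat.sub_add_cancel (by omega)] at h1
    exact h1.trans (by simp [Nat.ModEq])
  rw [← hshift _ _ hmod]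
  exact window_mem_factors_of_le (hmem x hxI) (by omega) (by omega)

theorem card_powerPairs_le (hp : 0 < p) (hf : Function.Periodic f p) :
    (powerPairs g N p f).card ≤ (circuitOrders g N p f).card := by
  classical
  rcases (powerPairs g N p f).eq_empty_or_nonempty with h0 | h0
  · simp [h0]
  obtain ⟨⟨i₀, m⟩, him, hmax⟩ := exists_max_image _ Prod.snd h0
  set I := (range p).filter fun i => (i, m) ∈ powerPairs g N p f
  have hmp : 2 ≤ m := (mem_powerPairs.1 him).2.1
  have hIne : I.Nonempty :=
    ⟨i₀, mem_filter.2 ⟨mem_range.2 (mem_powerPairs.1 him).1.1, him⟩⟩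
  have hImem : ∀ i ∈ I, window f i (m * p) ∈ factors g N (m * p) := fun i hi =>
    (mem_powerPairs.1 (mem_filter.1 hi).2).2.2
  have hIsub : I ⊆ range p := filter_subset _ _
  have hIp : I.card ≤ p := by simpa using card_le_card hIsub
  have hIpos := hIne.card_pos
  have hmN : m * p ≤ N := by
    obtain ⟨k, hk, -⟩ := mem_factors.1 (hImem _ hIne.choose_spec)
    omega
  -- With m the top exponent and I the conjugates reaching it, there are at most p(m - 2) + |I|
  -- powers.
  have hA : powerPairs g N p f ⊆ (range p ×ˢ Ico 2 m) ∪ (I ×ˢ {m}) := by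
    rintro ⟨i, t⟩ hit
    have h1 := mem_powerPairs.1 hit
    have h2 : t ≤ m := hmax _ hit
    have h3 := mem_range.2 h1.1.1
    rcases h2.eq_or_lt with rfl | hlt
    · exact mem_union_right _ (mem_product.2 ⟨mem_filter.2 ⟨h3, hit⟩, mem_singleton_self _⟩)
    · exact mem_union_left _ (mem_product.2 ⟨h3, mem_Ico.2 ⟨h1.2.1, hlt⟩⟩)
  obtain ⟨r, hr⟩ := Nat.exists_eq_add_of_le hmp
  have hexp : m * p = p + p + p * r := by rw [hr]; ring
  have hB : Ico p (p + p * r + I.card) ⊆ circuitOrders g N p f := by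
    intro n hn
    obtain ⟨hn1, hn2⟩ := mem_Ico.1 hn
    refine mem_circuitOrders.2 ⟨by omega, hn1, fun i => ?_⟩
    exact window_mem_factors_of_card hp hf hIsub hImem (by omega) hIne i
  calc _ ≤ _ := card_le_card hA
    _ ≤ _ := card_union_le _ _
    _ = p * r + I.card := by simp [hr]
    _ = (Ico p (p + p * r + I.card)).card := by rw [Nat.card_Ico]; omega
    _ ≤ _ := card_le_card hB

theorem sum_card_powerPairs_le [LinearOrder α] (hN : 0 < N) (P : Finset (ℕ × (ℕ → α)))
    (hP : ∀ c ∈ P, IsLyndon c.1 c.2) :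
    ∑ c ∈ P, (powerPairs g N c.1 c.2).card + (factors g N 1).card ≤ N := by
  classical
  let K (n : ℕ) : ℕ := (P.filter fun c => n ∈ circuitOrders g N c.1 c.2).card
  -- No circuit has order 0, so the telescoping starts at order 1, which leaves the alphabet term.
  have hK0 : K 0 = 0 := by
    refine card_eq_zero.2 (filter_eq_empty_iff.2 fun c hc h => ?_)
    have := (mem_circuitOrders.1 h).2.1
    have := (hP c hc).pos
    omega
  have hsum : ∑ c ∈ P, (powerPairs g N c.1 c.2).card ≤ ∑ n ∈ range N, K n := by
    calc _ ≤ ∑ c ∈ P, (circuitOrders g N c.1 c.2).card :=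
          sum_le_sum fun c hc => card_powerPairs_le (hP c hc).pos (hP c hc).periodic
      _ = ∑ c ∈ P, ∑ n ∈ range N, if n ∈ circuitOrders g N c.1 c.2 then 1 else 0 := by
          refine sum_congr rfl fun c _ => ?_
          rw [← card_filter]
          congr 1
          ext n
          simp only [mem_filter, iff_and_self]
          exact fun h => mem_range.2 (mem_circuitOrders.1 h).1
      _ = _ := by
          rw [sum_comm]
          exact sum_congr rfl fun n _ => (card_filter _ _).symm
  have htel (m : ℕ) (hm : m + 1 ≤ N) :
      ∑ n ∈ range (m + 1), K n + (factors g N 1).card ≤ (factors g N (m + 1)).card + m := by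
    induction m with
    | zero => simp [hK0]
    | succ m ih =>
      have h1 := ih (by omega)
      have h2 := card_factors_add_card_le (g := g) (n := m + 1)
        (P.filter fun c => m + 1 ∈ circuitOrders g N c.1 c.2) fun c hc => by
          obtain ⟨hc1, hc2⟩ := mem_filter.1 hc
          exact ⟨hP c hc1, (mem_circuitOrders.1 hc2).2⟩
      rw [sum_range_succ]
      change _ + K (m + 1) ≤ _ at h2
      omega
  have h1 := htel (N - 1) (by omega)
  rw [Nat.sub_add_cancel hN] at h1
  have h2 : (factors g N N).card ≤ 1 := card_factors_self_le
  omega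

end Count

/-! ### From powers of words to Lyndon sequences -/

section Powers

variable {α : Type*}

theorem wordPow_eq_window {f : ℕ → α} {k : ℕ} (hf : Function.Periodic f k) (t : ℕ) :
    wordPow (window f 0 k) t = window f 0 (t * k) := by
  induction t with
  | zero => simp [wordPow, window]
  | succ t ih =>
    have h : window f (0 + k) (t * k) = window f 0 (t * k) :=
      window_eq_iff.2 fun m _ => by rw [show 0 + k + m = 0 + m + k by ring, hf]
    rw [show (t + 1) * k = k + t * k by ring, window_add, h, ← ih]
    simp [wordPow, List.replicate_succ]

theorem window_getD (w : List α) (a : α) : window (fun i => w.getD i a) 0 w.length = w := by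
  apply List.ext_getElem (by simp)
  intro i h1 h2
  simp [window, h2]

theorem exists_isLyndon_of_power [LinearOrder α] {u : List α} (hu : u ≠ []) {t : ℕ} (ht : 2 ≤ t) :
    ∃ (p : ℕ) (f : ℕ → α) (i s : ℕ), IsLyndon p f ∧ i < p ∧ 2 ≤ s ∧
      wordPow u t = window f i (s * p) := by
  classical
  have hk : 0 < u.length := List.length_pos_iff.2 hu
  let F : ℕ → α := fun i => u.getD (i % u.length) (u.head hu)
  have hF : Function.Periodic F u.length := fun i => by simp [F]
  have hFu : window F 0 u.length = u := by
    conv_rhs => rw [← window_getD u (u.head hu)]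
    refine window_eq_iff.2 fun m hm => ?_
    simp [F, Nat.mod_eq_of_lt hm]
  have hex : ∃ d, 0 < d ∧ Function.Periodic F d := ⟨_, hk, hF⟩
  set p := Nat.find hex
  obtain ⟨hp, hpF⟩ : 0 < p ∧ Function.Periodic F p := Nat.find_spec hex
  have hmin : ∀ d, 0 < d → d < p → ¬ Function.Periodic F d := fun d h0 hd h =>
    Nat.find_min hex hd ⟨h0, h⟩
  have hdvd : p ∣ u.length := by
    rw [Nat.dvd_iff_mod_eq_zero]
    by_contra hne
    refine hmin _ (Nat.pos_of_ne_zero hne) (Nat.mod_lt _ hp) fun i => ?_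
    have h1 := (hpF.nat_mul (u.length / p)) (i + u.length % p)
    rw [← h1, ← hF i]
    congr 1
    have := Nat.mod_add_div' u.length p
    push_cast
    omega
  obtain ⟨q, hq⟩ := hdvd
  have hq0 : 0 < q := by
    rcases Nat.eq_zero_or_pos q with rfl | h
    · omega
    · exact h
  obtain ⟨d, hd, hdmin⟩ := exists_min_image (range p)
    (fun d => toLex fun k => F (d + k)) ⟨0, mem_range.2 hp⟩
  rw [mem_range] at hd
  have hle (a : ℕ) : (toLex fun k => F (d + k)) ≤ toLex fun k => F (a + k) := by
    have h1 := hdmin (a % p) (mem_range.2 (Nat.mod_lt _ hp))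
    have h2 : (fun k => F (a % p + k)) = fun k => F (a + k) := by
      funext k
      rw [← hpF.map_mod_nat (a % p + k), ← hpF.map_mod_nat (a + k), Nat.mod_add_mod]
    rwa [h2] at h1
  -- Here p is the least period and d the least shift; the reduction mod p handles d = 0.
  refine ⟨p, fun k => F (d + k), (p - d) % p, t * q, ⟨hp, fun i => ?_, fun a ha hap => ?_⟩,
    Nat.mod_lt _ hp, ?_, ?_⟩
  · rw [← add_assoc, hpF]
  · have hassoc : (fun k => F (d + (a + k))) = fun k => F (d + a + k) := by
      simp only [add_assoc]
    rw [hassoc]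
    refine lt_of_le_of_ne (hle _) fun he => hmin a ha hap fun i => ?_
    have h1 : F (d + (i + (p - d))) = F (d + a + (i + (p - d))) :=
      congrFun (toLex.injective he) _
    rw [show d + (i + (p - d)) = i + p by omega,
      show d + a + (i + (p - d)) = i + a + p by omega, hpF, hpF] at h1
    exact h1.symm
  · nlinarith
  · have h1 := wordPow_eq_window hF t
    rw [hFu] at h1
    rw [h1, show t * q * p = t * u.length by rw [hq]; ring, window_eq_iff]
    intro m _
    rw [← hpF.map_mod_nat (0 + m), ← hpF.map_mod_nat (d + _)]
    congr 1
    have h2 : d + ((p - d) % p + m) ≡ d + ((p - d) + m) [MOD p] :=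
      ((Nat.mod_modEq _ _).add_right m).add_left d
    rw [show d + (p - d + m) = 0 + m + p by omega] at h2
    have h3 : (d + ((p - d) % p + m)) % p = (0 + m + p) % p := h2
    rw [h3, Nat.add_mod_right]

theorem mem_Fac_iff {w : List α} (a : α) {x : List α} :
    x ∈ Fac w ↔ x ∈ factors (fun i => w.getD i a) w.length x.length := by
  rw [mem_factors]
  constructor
  · rintro ⟨y, z, rfl⟩
    refine ⟨y.length, by simp, ?_⟩
    apply List.ext_getElem (by simp)
    intro i h1 h2
    simp [window, List.getElem?_append, h2]
  · rintro ⟨i, hi, hx⟩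
    rw [← hx]
    have h1 := window_getD w a
    obtain ⟨r, hr⟩ := Nat.exists_eq_add_of_le hi
    rw [hr, window_add, window_add, zero_add] at h1
    exact ⟨_, _, h1⟩

theorem ncard_Alph_le (w : List α) (a : α) :
    (Alph w).ncard ≤ (factors (fun i => w.getD i a) w.length 1).card := by
  rw [← Set.ncard_coe_finset]
  refine Set.ncard_le_ncard_of_injOn (fun b => [b]) (fun b hb => ?_)
    (fun b _ c _ h => by simpa using h) (finite_toSet _)
  exact (mem_Fac_iff (x := [b]) a).1 ((List.singleton_infix_iff b w).2 hb)

theorem finite_Powers (w : List α) : (Powers w).Finite := by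
  refine (List.finite_toSet w.sublists).subset fun x hx => ?_
  exact List.mem_sublists.2 hx.1.sublist

theorem ncard_Powers_add_ncard_Alph_le (w : List α) :
    (Powers w).ncard + (Alph w).ncard ≤ w.length := by
  classical
  rcases w.eq_nil_or_concat' with rfl | ⟨w', a, hw⟩
  · have h1 : Powers ([] : List α) = ∅ := by
      refine Set.eq_empty_iff_forall_notMem.2 ?_
      rintro x ⟨hx, u, t, hu, ht, rfl⟩
      have := List.infix_nil.1 hx
      obtain ⟨t, rfl⟩ := Nat.exists_eq_add_of_le' ht
      simp [wordPow, List.replicate_succ, hu] at this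
    simp [h1, Alph]
  let _ : LinearOrder α := linearOrderOfSTO WellOrderingRel
  have hlen : 0 < w.length := by simp [hw]
  set g : ℕ → α := fun i => w.getD i a
  set N := w.length
  have hrep : ∀ x ∈ Powers w, ∃ c : ℕ × (ℕ → α), IsLyndon c.1 c.2 ∧
      ∃ b ∈ powerPairs g N c.1 c.2, x = window c.2 b.1 (b.2 * c.1) := by
    rintro x ⟨hx, u, t, hu, ht, rfl⟩
    obtain ⟨p, f, i, s, hL, hi, hs, he⟩ := exists_isLyndon_of_power hu ht
    rw [mem_Fac_iff a, he, length_window] at hx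
    refine ⟨(p, f), hL, (i, s), mem_powerPairs.2 ⟨⟨hi, ?_⟩, hs, hx⟩, he⟩
    obtain ⟨k, hk, -⟩ := mem_factors.1 hx
    have := Nat.le_mul_of_pos_right s hL.pos
    exact Nat.lt_succ_of_le (by omega)
  have : Nonempty α := ⟨a⟩
  choose! c hc using hrep
  have hfin := finite_Powers w
  let P := hfin.toFinset.image c
  have hP : ∀ d ∈ P, IsLyndon d.1 d.2 := by
    intro d hd
    obtain ⟨x, hx, rfl⟩ := mem_image.1 hd
    exact (hc x (hfin.mem_toFinset.1 hx)).1
  have hsub : hfin.toFinset ⊆ P.biUnion fun d =>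
      (powerPairs g N d.1 d.2).image fun b => window d.2 b.1 (b.2 * d.1) := by
    intro x hx
    obtain ⟨-, b, hb, he⟩ := hc x (hfin.mem_toFinset.1 hx)
    exact mem_biUnion.2 ⟨c x, mem_image_of_mem c hx, mem_image.2 ⟨b, hb, he.symm⟩⟩
  have h1 : (Powers w).ncard ≤ ∑ d ∈ P, (powerPairs g N d.1 d.2).card := by
    rw [Set.ncard_eq_toFinset_card _ hfin]
    exact (card_le_card hsub).trans (card_biUnion_le.trans (sum_le_sum fun _ _ => card_image_le))
  have h2 := sum_card_powerPairs_le (g := g) hlen P hP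
  have h3 : (Alph w).ncard ≤ (factors g N 1).card := ncard_Alph_le w a
  omega

end Powers

end FiniteWord

theorem mainTheorem1 {α : Type*} (w : List α) :
    (FiniteWord.Powers w).Finite ∧
    ((FiniteWord.Powers w).ncard : ℤ) ≤ (w.length : ℤ) - ((FiniteWord.Alph w).ncard : ℤ) ∧
    (w ≠ [] → ((FiniteWord.Powers w).ncard : ℤ) ≤ (w.length : ℤ) - 1) := by
  have h := FiniteWord.ncard_Powers_add_ncard_Alph_le w
  refine ⟨FiniteWord.finite_Powers w, by omega, fun hw => ?_⟩
  have h1 : 0 < (FiniteWord.Alph w).ncard :=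
    (Set.ncard_pos (List.finite_toSet w)).2 ⟨w.head hw, List.head_mem hw⟩
  omega
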